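/- Let $F_0$ be a finite simple graph with chromatic number $m=\chi(F_0)$, and let $r,k$ be integers with $m>r>k\ge 2$. Let $F_0^{+k}$ be the expansion of $F_0$, i.e. the $k$-uniform hypergraph obtained from $F_0$ by adding $k-2$ new vertices to each edge of $F_0$, such that the new vertices are distinct for distinct edges. Let $\mathcal K_r^{(k)}$ be the complete $k$-uniform hypergraph on $r$ vertices. Let $\mathrm{ex}_k(n,\mathcal K_r^{(k)},F_0^{+k})$ be the maximum number of subhypergraphs isomorphic to $\mathcal K_r^{(k)}$ in a $k$-uniform hypergraph on $n$ vertices that has no (not necessarily induced) subhypergraph isomorphic to $F_0^{+k}$. Let $T^r(n,m-1)$ be the $r$-uniform Turán hypergraph: its $n$ vertices are partitioned into $m-1$ parts whose sizes differ pairwise by at most $1$, and its hyperedges are the $r$-sets that meet every part in at most one vertex. Then, as $n\to\infty$ with $F_0,r,k$ fixed, $$\mathrm{ex}_k(n,\mathcal K_r^{(k)},F_0^{+k})=(1+o(1))\,|E(T^r(n,m-1))|.$$ -/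

import Mathlib

open Filter Asymptotics
open scoped Hypergraph

namespace Hypergraph

/-- `H` is a `k`-graph: every hyperedge has exactly `k` vertices. -/
def IsUniform {α : Type*} (H : Hypergraph α) (k : ℕ) : Prop :=
  ∀ e ∈ E(H), e.encard = k

/-- `S` is a (not necessarily induced) subhypergraph of `H`. -/
def IsSub {α : Type*} (S H : Hypergraph α) : Prop :=
  V(S) ⊆ V(H) ∧ E(S) ⊆ E(H)

/-- `H` and `H'` are isomorphic: there is a bijection between the vertex sets under which
hyperedges correspond to hyperedges in both directions. -/
def IsIso {α β : Type*} (H : Hypergraph α) (H' : Hypergraph β) : Prop :=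
  ∃ f : V(H) ≃ V(H'), ∀ e : Set V(H),
    (Subtype.val '' e) ∈ E(H) ↔ (Subtype.val '' (f '' e)) ∈ E(H')

/-- `N(K, H)`: the number of subhypergraphs of `H` that are isomorphic to `K`. -/
noncomputable def numCopies {α β : Type*} (K : Hypergraph α) (H : Hypergraph β) : ℕ :=
  {S : Hypergraph β | S.IsSub H ∧ K.IsIso S}.ncard

/-- `H` is `F`-free: no subhypergraph of `H` is isomorphic to `F`. -/
def IsFree {α β : Type*} (F : Hypergraph α) (H : Hypergraph β) : Prop :=
  ∀ S : Hypergraph β, S.IsSub H → ¬ F.IsIso S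

/-- The numbers of copies of `K` in the `F`-free `k`-graphs on `n` vertices. -/
def copyCounts {α β : Type*} (k n : ℕ) (K : Hypergraph α) (F : Hypergraph β) : Set ℕ :=
  {N | ∃ H : Hypergraph (Fin n),
    V(H) = Set.univ ∧ H.IsUniform k ∧ IsFree F H ∧ numCopies K H = N}

/-- The generalized Turán number `ex_k(n, K, F)`: the maximum number of copies of `K` in an
`F`-free `k`-graph on `n` vertices. -/
noncomputable def ex {α β : Type*} (k n : ℕ) (K : Hypergraph α) (F : Hypergraph β) : ℕ :=
  sSup (copyCounts k n K F)

/-- The supremum in `ex` is a maximum as soon as there is some `F`-free `k`-graph on `n`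
vertices. -/
theorem isGreatest_ex {α β : Type*} (k n : ℕ) (K : Hypergraph α) (F : Hypergraph β)
    (h : (copyCounts k n K F).Nonempty) :
    IsGreatest (copyCounts k n K F) (ex k n K F) := by
  have hfin : Finite (Hypergraph (Fin n)) :=
    Finite.of_injective (fun H : Hypergraph (Fin n) => (V(H), E(H))) fun H H' hH => by
      simp only [Prod.mk.injEq] at hH
      exact Hypergraph.ext hH.1 hH.2
  have hb : BddAbove (copyCounts k n K F) := by
    refine ((Set.finite_range fun H : Hypergraph (Fin n) => numCopies K H).subset ?_).bddAbove
    rintro N ⟨H, -, -, -, rfl⟩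
    exact ⟨H, rfl⟩
  exact ⟨Nat.sSup_mem h hb, fun N hN => le_csSup hb hN⟩

/-- The complete `k`-graph `K_s^{(k)}` on `s` vertices. -/
def completeUniform (k s : ℕ) : Hypergraph (Fin s) where
  vertexSet := Set.univ
  edgeSet := {e | e.encard = k}
  subset_vertexSet_of_mem_edgeSet' := fun _ _ => Set.subset_univ _

/-- The expansion `F^{+k}` (for `k ≥ 2`) of a graph `F`: the vertices are those of `F` together
with `k - 2` new vertices `(e, 0), …, (e, k - 3)` for each edge `e` of `F`, and the hyperedges are
the edges of `F`, each enlarged by its own new vertices. -/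
def expansion {V : Type*} (F : SimpleGraph V) (k : ℕ) :
    Hypergraph (V ⊕ (F.edgeSet × Fin (k - 2))) where
  vertexSet := Set.univ
  edgeSet := Set.range fun e : F.edgeSet =>
    Sum.inl '' {v : V | v ∈ e.1} ∪ Sum.inr '' {p : F.edgeSet × Fin (k - 2) | p.1 = e}
  subset_vertexSet_of_mem_edgeSet' := fun _ _ => Set.subset_univ _

/-- The Turán hypergraph `T^r(n, t)`: the vertex set `{0, …, n - 1}` is split into `t` parts, the
residue classes modulo `t` (whose sizes differ by at most one), and the hyperedges are the
`r`-sets that meet every part in at most one vertex. -/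
def turan (r n t : ℕ) : Hypergraph (Fin n) where
  vertexSet := Set.univ
  edgeSet := {e | e.encard = r ∧ Set.InjOn (fun v : Fin n => (v : ℕ) % t) e}
  subset_vertexSet_of_mem_edgeSet' := fun _ _ => Set.subset_univ _

end Hypergraph

/-!
The lower bound is witnessed by the Turán hypergraph `T^k(n, m - 1)`: the parts of its vertex set
would properly `(m - 1)`-colour `F₀` in any copy of the expansion, and its complete subhypergraphs on
`r` vertices are exactly the edges of `T^r(n, m - 1)` (`Hypergraph.le_ex_turan`).

For the upper bound, let `H` be free of the expansion, and call a pair of vertices heavy if no bounded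
set of other vertices meets all hyperedges through the pair (`Hypergraph.heavyGraph`). A copy of `F₀`
among the heavy pairs extends greedily to a copy of the expansion
(`Hypergraph.not_isFree_expansion`), so the graph of heavy pairs is `F₀`-free. A clique of `H` that
contains a light pair also meets the bounded set blocking that pair, since otherwise it would contain
a hyperedge through the pair avoiding the blocking set. Hence there are only `O(n ^ (r - 1))` such
cliques (`Hypergraph.card_orderings_cliqueSets_le`), and what is left to bound is the number of
`r`-cliques in the graph of heavy pairs.

An `F₀`-free graph has `o(n ^ m)` cliques of size `m`: otherwise, by Erdős's theorem on dense
`m`-partite relations (`exists_product_subset_of_dense`), it would contain a complete `m`-partite graph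
with parts of size `|V(F₀)|`, and hence `F₀`. The Moon–Moser inequalities
(`SimpleGraph.moon_moser`), applied from clique size `m` downwards, then bound the densities of
smaller cliques by those of the balanced complete `(m - 1)`-partite graph up to `o(1)`
(`exists_cliqueDensity_le`). This replaces both the graph removal lemma and Zykov's theorem.

Cliques and edges are counted as ordered tuples throughout, which makes the densities products of
the factors `1 - s / (m - 1)`.
-/

/-! ### Moon–Moser inequalities for ordered cliques -/

section OrderedCliques

open Finset

open scoped Classical in
/-- The ordered `s`-cliques of `G`, as tuples of pairwise adjacent vertices. -/
noncomputable def SimpleGraph.orderedCliques {X : Type*} [Fintype X] (G : SimpleGraph X) (s : ℕ) :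
    Finset (Fin s → X) :=
  {x | Pairwise fun i j => G.Adj (x i) (x j)}

open scoped Classical in
/-- The vertices adjacent to every entry of a tuple. -/
noncomputable def SimpleGraph.tupleNeighbors {X : Type*} [Fintype X] (G : SimpleGraph X) {s : ℕ}
    (x : Fin s → X) : Finset X :=
  {w | ∀ i, G.Adj w (x i)}

namespace SimpleGraph

variable {X : Type*} [Fintype X] (G : SimpleGraph X) {s : ℕ}

theorem mem_orderedCliques {x : Fin s → X} :
    x ∈ G.orderedCliques s ↔ Pairwise fun i j => G.Adj (x i) (x j) := by
  simp [orderedCliques]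

theorem mem_tupleNeighbors {x : Fin s → X} {w : X} :
    w ∈ G.tupleNeighbors x ↔ ∀ i, G.Adj w (x i) := by
  simp [tupleNeighbors]

/-- An ordered `(s + 1)`-clique is an ordered `s`-clique together with a common neighbor, inserted at
any fixed position. -/
theorem insertNth_mem_orderedCliques (i : Fin (s + 1)) (w : X) (x : Fin s → X) :
    (i.insertNth w x : Fin (s + 1) → X) ∈ G.orderedCliques (s + 1) ↔
      x ∈ G.orderedCliques s ∧ w ∈ G.tupleNeighbors x := by
  simp only [mem_orderedCliques, mem_tupleNeighbors]
  constructor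
  · intro h
    refine ⟨fun a b hab => ?_, fun a => ?_⟩
    · simpa using h (i.succAbove_right_injective.ne hab)
    · simpa using h (i.succAbove_ne a).symm
  · rintro ⟨h₁, h₂⟩ a b hab
    induction a using i.succAboveCases with
    | x =>
      induction b using i.succAboveCases with
      | x => exact absurd rfl hab
      | p b => simpa using h₂ b
    | p a =>
      induction b using i.succAboveCases with
      | x => simpa using (h₂ a).symm
      | p b => simpa using h₁ (fun h => hab (by rw [h]))

/-- Summing over ordered `(s + 1)`-cliques a quantity that ignores the `i`-th entry. -/
theorem sum_orderedCliques_succ (i : Fin (s + 1)) (f : (Fin s → X) → ℕ) :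
    ∑ x ∈ G.orderedCliques (s + 1), f (i.removeNth x) =
      ∑ y ∈ G.orderedCliques s, #(G.tupleNeighbors y) * f y := by
  classical
  have h : ∑ x ∈ G.orderedCliques (s + 1), f (i.removeNth x) =
      ∑ p ∈ (G.orderedCliques s).sigma fun y => G.tupleNeighbors y, f p.1 := by
    refine Finset.sum_bij' (fun x _ => ⟨i.removeNth x, x i⟩)
      (fun p _ => i.insertNth p.2 p.1) ?_ ?_ ?_ ?_ ?_
    · intro x hx
      rw [Finset.mem_sigma, ← insertNth_mem_orderedCliques G i]
      simpa using hx
    · intro p hp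
      rw [Finset.mem_sigma] at hp
      exact (G.insertNth_mem_orderedCliques i _ _).2 hp
    · intro x _
      simp
    · intro p _
      simp
    · intro x _
      rfl
  rw [h, Finset.sum_sigma]
  simp

theorem card_orderedCliques_succ :
    #(G.orderedCliques (s + 1)) = ∑ y ∈ G.orderedCliques s, #(G.tupleNeighbors y) := by
  simpa using G.sum_orderedCliques_succ (0 : Fin (s + 1)) fun _ => 1

theorem card_orderedCliques_zero : #(G.orderedCliques 0) = 1 := by
  have : G.orderedCliques 0 = Finset.univ := by
    ext x
    simp only [mem_orderedCliques, mem_univ, iff_true]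
    exact fun i => i.elim0
  rw [this]
  simp

/-- A vertex that misses some entry of `x` is adjacent to all the other entries for at most one
choice of the omitted entry. -/
theorem sum_card_tupleNeighbors_removeNth_le (x : Fin (s + 1) → X) :
    ∑ i : Fin (s + 1), #(G.tupleNeighbors (i.removeNth x)) ≤
      Fintype.card X + s * #(G.tupleNeighbors x) := by
  classical
  have h1 : ∀ i : Fin (s + 1), #(G.tupleNeighbors (i.removeNth x)) =
      ∑ w : X, if ∀ j, G.Adj w (i.removeNth x j) then 1 else 0 := by
    intro i
    rw [tupleNeighbors, Finset.card_filter]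
  have h2 : Fintype.card X + s * #(G.tupleNeighbors x) =
      ∑ w : X, (1 + s * if ∀ j, G.Adj w (x j) then 1 else 0) := by
    rw [Finset.sum_add_distrib, ← Finset.mul_sum, tupleNeighbors, Finset.card_filter]
    simp
  rw [h2, Finset.sum_congr rfl fun i _ => h1 i, Finset.sum_comm]
  refine Finset.sum_le_sum fun w _ => ?_
  by_cases hw : ∀ j, G.Adj w (x j)
  · rw [if_pos hw]
    calc _ ≤ ∑ i : Fin (s + 1), 1 := Finset.sum_le_sum fun i _ => by split_ifs <;> simp
      _ = _ := by simp [add_comm]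
  · rw [if_neg hw, ← Finset.card_filter]
    push Not at hw
    obtain ⟨j, hj⟩ := hw
    simp only [mul_zero, add_zero]
    rw [Finset.card_le_one_iff_subset_singleton]
    refine ⟨j, fun i hi => ?_⟩
    rw [Finset.mem_filter] at hi
    by_contra hij
    rw [Finset.mem_singleton] at hij
    obtain ⟨l, rfl⟩ := Fin.exists_succAbove_eq (Ne.symm hij)
    exact hj (hi.2 l)

/-- The Moon–Moser inequality: the numbers `h_s` of ordered `s`-cliques of a graph on `n` vertices
satisfy `(s + 1) h_{s+1}² ≤ n h_{s+1} h_s + s h_{s+2} h_s`. -/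
theorem moon_moser :
    (s + 1) * #(G.orderedCliques (s + 1)) ^ 2 ≤
      Fintype.card X * #(G.orderedCliques (s + 1)) * #(G.orderedCliques s) +
        s * #(G.orderedCliques (s + 2)) * #(G.orderedCliques s) := by
  have h1 : (s + 1) * ∑ y ∈ G.orderedCliques s, #(G.tupleNeighbors y) ^ 2 ≤
      Fintype.card X * #(G.orderedCliques (s + 1)) + s * #(G.orderedCliques (s + 2)) := by
    have := Finset.sum_le_sum fun x (_ : x ∈ G.orderedCliques (s + 1)) =>
      G.sum_card_tupleNeighbors_removeNth_le x
    rw [Finset.sum_comm, Finset.sum_congr rfl fun i _ =>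
      G.sum_orderedCliques_succ i fun y => #(G.tupleNeighbors y), Finset.sum_add_distrib,
      ← Finset.mul_sum, ← card_orderedCliques_succ] at this
    simpa [sq, mul_comm] using this
  have h2 := sq_sum_le_card_mul_sum_sq (s := G.orderedCliques s)
    (f := fun y => #(G.tupleNeighbors y))
  rw [← card_orderedCliques_succ] at h2
  calc _ ≤ (s + 1) * (#(G.orderedCliques s) *
        ∑ y ∈ G.orderedCliques s, #(G.tupleNeighbors y) ^ 2) := Nat.mul_le_mul_left _ h2
    _ = #(G.orderedCliques s) * ((s + 1) *
        ∑ y ∈ G.orderedCliques s, #(G.tupleNeighbors y) ^ 2) := by ring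
    _ ≤ _ := Nat.mul_le_mul_left _ h1
    _ = _ := by ring

/-- The density of ordered `s`-cliques among all `s`-tuples of vertices. -/
noncomputable def cliqueDensity (s : ℕ) : ℝ := #(G.orderedCliques s) / (Fintype.card X : ℝ) ^ s

theorem cliqueDensity_nonneg : 0 ≤ G.cliqueDensity s := by
  unfold cliqueDensity
  positivity

theorem cliqueDensity_le_one : G.cliqueDensity s ≤ 1 := by
  unfold cliqueDensity
  refine div_le_one_of_le₀ ?_ (by positivity)
  have := Finset.card_le_univ (G.orderedCliques s)
  rw [Fintype.card_fun, Fintype.card_fin] at this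
  exact_mod_cast this

theorem cliqueDensity_zero : G.cliqueDensity 0 = 1 := by
  simp [cliqueDensity, card_orderedCliques_zero]

theorem cliqueDensity_moon_moser [Nonempty X] :
    (s + 1) * G.cliqueDensity (s + 1) ^ 2 ≤ G.cliqueDensity (s + 1) * G.cliqueDensity s +
      s * G.cliqueDensity (s + 2) * G.cliqueDensity s := by
  have hn : (0 : ℝ) < Fintype.card X := by exact_mod_cast Fintype.card_pos
  have h : ((s + 1) * #(G.orderedCliques (s + 1)) ^ 2 : ℝ) ≤
      Fintype.card X * #(G.orderedCliques (s + 1)) * #(G.orderedCliques s) +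
        s * #(G.orderedCliques (s + 2)) * #(G.orderedCliques s) := by
    exact_mod_cast G.moon_moser (s := s)
  unfold cliqueDensity
  set n : ℝ := (Fintype.card X : ℝ)
  have h' := div_le_div_of_nonneg_right h (by positivity : 0 ≤ n ^ (2 * s + 2))
  calc _ = _ := by field_simp; ring
    _ ≤ _ := h'
    _ = _ := by field_simp; ring

end SimpleGraph

/-- If the density of `(t + 1)`-cliques is small, the clique densities decay at least as fast as
those of the balanced complete `t`-partite graph, up to a small error. -/
theorem exists_cliqueDensity_succ_le {t : ℕ} {s : ℕ} (hs : s ≤ t) {ε : ℝ} (hε : 0 < ε) :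
    ∃ δ > 0, ∀ {X : Type} [Fintype X] [Nonempty X] (G : SimpleGraph X),
      G.cliqueDensity (t + 1) ≤ δ →
        G.cliqueDensity (s + 1) ≤ (1 - s / t) * G.cliqueDensity s + ε := by
  induction hs using Nat.decreasingInduction generalizing ε with
  | self =>
    refine ⟨ε, hε, fun G hG => ?_⟩
    have h : 0 ≤ (1 - (t : ℝ) / t) * G.cliqueDensity t :=
      mul_nonneg (sub_nonneg.2 (div_self_le_one _)) G.cliqueDensity_nonneg
    linarith
  | of_succ s hs ih =>
    -- Moon–Moser bounds `y (y - a x)` by the previous error, so the error is a square root of it.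
    obtain ⟨δ, hδ, h⟩ := ih (ε := ε ^ 2) (by positivity)
    refine ⟨δ, hδ, fun G hG => ?_⟩
    have h1 := h G hG
    have h2 := G.cliqueDensity_moon_moser (s := s)
    have ht : (0 : ℝ) < t := by exact_mod_cast (Nat.zero_le s).trans_lt hs
    have p0 := G.cliqueDensity_nonneg (s := s)
    have p1 := G.cliqueDensity_le_one (s := s)
    have p2 := G.cliqueDensity_nonneg (s := s + 1)
    have ha : 0 ≤ 1 - (s : ℝ) / t := by
      rw [sub_nonneg, div_le_one ht]
      exact_mod_cast hs.le
    push_cast at h1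
    have e : (1 : ℝ) + s * (1 - (s + 1) / t) = (s + 1) * (1 - s / t) := by
      field_simp
      ring
    set a : ℝ := 1 - (s : ℝ) / t
    set b : ℝ := 1 - ((s : ℝ) + 1) / t
    set x := G.cliqueDensity s
    set y := G.cliqueDensity (s + 1)
    have h3 : (s : ℝ) * G.cliqueDensity (s + 1 + 1) * x ≤ s * (b * y + ε ^ 2) * x := by
      gcongr
    have h4 : (s + 1) * (y * (y - a * x)) ≤ (s + 1) * ε ^ 2 := by
      have e' : y * x + s * (b * y) * x = (s + 1) * a * (y * x) := by
        rw [← e]; ring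
      have : s * ε ^ 2 * x ≤ s * ε ^ 2 * 1 := by gcongr
      nlinarith [sq_nonneg ε]
    -- If `y` exceeded `a x + ε`, both factors below would exceed `ε`.
    have h5 : y * (y - a * x) ≤ ε ^ 2 := le_of_mul_le_mul_left h4 (by positivity)
    by_contra! hc
    have h6 : ε < y - a * x := by linarith
    have h7 : ε < y := by nlinarith
    nlinarith

/-- The limit `t (t - 1) ⋯ (t - r + 1) / t ^ r` of the density of ordered `r`-cliques in balanced
complete `t`-partite graphs. -/
noncomputable def turanCliqueDensity (t r : ℕ) : ℝ := ∏ s ∈ range r, (1 - (s : ℝ) / t)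

/-- A stability form of Zykov's theorem: few `(t + 1)`-cliques force the `r`-clique density to be at
most about that of the balanced complete `t`-partite graph. -/
theorem exists_cliqueDensity_le {t : ℕ} {r : ℕ} (hr : r ≤ t) {ε : ℝ} (hε : 0 < ε) :
    ∃ δ > 0, ∀ {X : Type} [Fintype X] [Nonempty X] (G : SimpleGraph X),
      G.cliqueDensity (t + 1) ≤ δ → G.cliqueDensity r ≤ turanCliqueDensity t r + ε := by
  induction r generalizing ε with
  | zero =>
    refine ⟨1, one_pos, fun G _ => ?_⟩
    simp [turanCliqueDensity, G.cliqueDensity_zero, hε.le]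
  | succ r ih =>
    obtain ⟨δ₁, hδ₁, h₁⟩ := ih (Nat.le_of_succ_le hr) (half_pos hε)
    obtain ⟨δ₂, hδ₂, h₂⟩ := exists_cliqueDensity_succ_le (Nat.le_of_succ_le hr) (half_pos hε)
    refine ⟨min δ₁ δ₂, lt_min hδ₁ hδ₂, fun G hG => ?_⟩
    have h₁ := h₁ G (hG.trans (min_le_left _ _))
    have h₂ := h₂ G (hG.trans (min_le_right _ _))
    have ht : (0 : ℝ) < t := by exact_mod_cast (Nat.succ_pos r).trans_le hr
    have ha : 0 ≤ 1 - (r : ℝ) / t := by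
      rw [sub_nonneg, div_le_one ht]
      exact_mod_cast Nat.le_of_succ_le hr
    have ha' : 1 - (r : ℝ) / t ≤ 1 := by
      have : 0 ≤ (r : ℝ) / t := by positivity
      linarith
    rw [turanCliqueDensity, prod_range_succ, ← turanCliqueDensity]
    nlinarith

theorem turanCliqueDensity_pos {t r : ℕ} (hr : r ≤ t) : 0 < turanCliqueDensity t r := by
  refine prod_pos fun s hs => ?_
  have hst : s < t := (mem_range.1 hs).trans_le hr
  have ht : (0 : ℝ) < t := by exact_mod_cast (Nat.zero_le s).trans_lt hst
  rw [sub_pos, div_lt_one ht]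
  exact_mod_cast hst

theorem turanCliqueDensity_eq {t r : ℕ} (hr : r ≤ t) :
    turanCliqueDensity t r = t.descFactorial r / (t : ℝ) ^ r := by
  induction r with
  | zero => simp [turanCliqueDensity]
  | succ r ih =>
    have ht : (0 : ℝ) < t := by exact_mod_cast (Nat.succ_pos r).trans_le hr
    rw [turanCliqueDensity, prod_range_succ, ← turanCliqueDensity, ih (Nat.le_of_succ_le hr),
      Nat.descFactorial_succ]
    push_cast [Nat.le_of_succ_le hr]
    field_simp
    ring

end OrderedCliques

/-! ### Complete multipartite patterns in dense relations -/

section DenseRelations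

open Finset

/-- Non-injective functions `V → X` are few: at most a proportion `|V|² / |X|` of all functions. -/
theorem card_filter_not_injective_le {V X : Type*} [Fintype V] [Fintype X] [DecidableEq V]
    [DecidableEq X] :
    #{T : V → X | ¬ Function.Injective T} * Fintype.card X ≤
      Fintype.card V ^ 2 * Fintype.card X ^ Fintype.card V := by
  classical
  have hsub : ({T : V → X | ¬ Function.Injective T} : Finset (V → X)) ⊆
      (univ : Finset (V × V)).biUnion fun p => {T : V → X | p.1 ≠ p.2 ∧ T p.1 = T p.2} := by
    intro T hT
    simp only [mem_filter, mem_univ, true_and, Function.Injective, not_forall] at hT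
    obtain ⟨a, b, h, hab⟩ := hT
    simp only [mem_biUnion, mem_univ, true_and, mem_filter]
    exact ⟨(a, b), hab, h⟩
  have hone : ∀ p : V × V, #{T : V → X | p.1 ≠ p.2 ∧ T p.1 = T p.2} * Fintype.card X ≤
      Fintype.card X ^ Fintype.card V := by
    rintro ⟨a, b⟩
    rw [← Fintype.card_fun, ← card_univ, ← card_univ, ← card_product]
    refine card_le_card_of_injOn (fun q => Function.update q.1 a q.2) (fun _ _ => by simp) ?_
    rintro ⟨T, x⟩ hT ⟨T', x'⟩ hT' h
    simp only [coe_product, Set.mem_prod, mem_coe, mem_filter, mem_univ, true_and, and_true]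
      at hT hT'
    simp only at h
    have hx : x = x' := by simpa using congrFun h a
    have hne : ∀ c, c ≠ a → T c = T' c := fun c hc => by simpa [hc] using congrFun h c
    have hT2 : T = T' := by
      funext c
      by_cases hc : c = a
      · rw [hc, hT.2, hT'.2, hne b hT.1.symm]
      · exact hne c hc
    rw [hT2, hx]
  calc _ ≤ (∑ p : V × V, #{T : V → X | p.1 ≠ p.2 ∧ T p.1 = T p.2}) * Fintype.card X :=
        Nat.mul_le_mul_right _ ((card_le_card hsub).trans card_biUnion_le)
    _ = ∑ p : V × V, #{T : V → X | p.1 ≠ p.2 ∧ T p.1 = T p.2} * Fintype.card X :=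
        sum_mul ..
    _ ≤ ∑ p : V × V, Fintype.card X ^ Fintype.card V := sum_le_sum fun p _ => hone p
    _ = _ := by simp [sq]

/-- Erdős's theorem on complete multipartite patterns: for large `X`, a set of `m`-tuples in `X` of
positive density contains a product `A 0 × ⋯ × A (m - 1)` of sets of a prescribed size. The sets
are indexed injectively by `V`. -/
theorem exists_product_subset_of_dense (V : Type*) [Finite V] (m : ℕ) {δ : ℝ} (hδ : 0 < δ) :
    ∃ N : ℕ, ∀ (X : Type) [Fintype X], N ≤ Fintype.card X →
      ∀ R : Finset (Fin m → X), δ * (Fintype.card X : ℝ) ^ m ≤ #R →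
        ∃ A : Fin m → V → X, (∀ i, Function.Injective (A i)) ∧
          ∀ v : Fin m → V, (fun i => A i (v i)) ∈ R := by
  classical
  have := Fintype.ofFinite V
  induction m generalizing δ with
  | zero =>
    refine ⟨0, fun X _ _ R hR => ⟨Fin.elim0, fun i => i.elim0, fun v => ?_⟩⟩
    have hpos : (0 : ℝ) < #R := lt_of_lt_of_le (by simpa using hδ) hR
    obtain ⟨x, hx⟩ := card_pos.1 (by exact_mod_cast hpos : 0 < #R)
    convert hx
  | succ m ih =>
    set t := Fintype.card V with ht
    obtain ⟨N, hN⟩ := ih (δ := δ ^ t / 2) (by positivity)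
    obtain ⟨N', hN'⟩ := exists_nat_gt (2 * (t : ℝ) ^ 2 / δ ^ t)
    refine ⟨max N (N' + 1), fun X _ hX R hR => ?_⟩
    set n := Fintype.card X with hn
    have hNn : N ≤ n := (le_max_left _ _).trans hX
    have hn0 : 0 < n := (Nat.succ_pos _).trans_le ((le_max_right _ _).trans hX)
    have hn0' : (0 : ℝ) < n := by exact_mod_cast hn0
    have hnt : 2 * (t : ℝ) ^ 2 / δ ^ t < n :=
      hN'.trans (by exact_mod_cast (le_max_right _ _).trans hX)
    -- `d y` counts the extensions of `y` to a member of `R`, `R' T` the common tails of `T`.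
    let d : (Fin m → X) → ℕ := fun y => #{x : X | (Fin.cons x y : Fin (m + 1) → X) ∈ R}
    let R' : (V → X) → Finset (Fin m → X) :=
      fun T => {y | ∀ v, (Fin.cons (T v) y : Fin (m + 1) → X) ∈ R}
    have hd : ∑ y, d y = #R := by
      have : #R = ∑ y, #{x ∈ R | Fin.tail x = y} :=
        card_eq_sum_card_fiberwise fun _ _ => mem_coe.2 (mem_univ _)
      rw [this]
      refine sum_congr rfl fun y _ => ?_
      refine card_bij' (fun x _ => (Fin.cons x y : Fin (m + 1) → X)) (fun x _ => x 0) ?_ ?_ ?_ ?_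
      · intro x hx
        simpa using hx
      · intro x hx
        rw [mem_filter] at hx
        rw [mem_filter, ← hx.2, Fin.cons_self_tail]
        exact ⟨mem_univ _, hx.1⟩
      · intro x _
        simp
      · intro x hx
        rw [mem_filter] at hx
        simp only [← hx.2, Fin.cons_self_tail]
    have hdR : ∑ T, #(R' T) = ∑ y, d y ^ t := by
      simp only [R', card_filter]
      rw [sum_comm]
      refine sum_congr rfl fun y _ => ?_
      rw [← card_filter]
      have : ({T : V → X | ∀ v, (Fin.cons (T v) y : Fin (m + 1) → X) ∈ R} : Finset (V → X)) =
          Fintype.piFinset fun _ : V =>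
            ({x : X | (Fin.cons x y : Fin (m + 1) → X) ∈ R} : Finset X) := by
        ext T
        simp [Fintype.mem_piFinset]
      rw [this, Fintype.card_piFinset]
      simp [d, ht]
    have hlow : δ ^ t * (n : ℝ) ^ (m + t) ≤ ∑ T, (#(R' T) : ℝ) := by
      -- Jensen's inequality for `z ↦ z ^ t`.
      have hj : ((∑ y, (d y : ℝ)) / n ^ m) ^ t * n ^ m ≤ ∑ y, (d y : ℝ) ^ t := by
        obtain h0 | ⟨t', ht'⟩ : t = 0 ∨ ∃ t', t = t' + 1 := by
          cases t with
          | zero => exact .inl rfl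
          | succ t' => exact .inr ⟨t', rfl⟩
        · simp [h0, hn]
        · have h := pow_sum_div_card_le_sum_pow (s := (univ : Finset (Fin m → X)))
            (f := fun y => (d y : ℝ)) (fun y _ => by positivity) t'
          rw [ht']
          refine le_trans (le_of_eq ?_) h
          rw [card_univ, Fintype.card_fun, Fintype.card_fin, ← hn]
          push_cast
          rw [div_pow]
          field_simp
          ring
      have : δ * n ≤ (∑ y, (d y : ℝ)) / n ^ m := by
        rw [le_div_iff₀ (by positivity)]
        have : (∑ y, (d y : ℝ)) = #R := by exact_mod_cast hd
        rw [this]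
        calc _ = δ * (n : ℝ) ^ (m + 1) := by ring
          _ ≤ _ := hR
      calc _ = (δ * n) ^ t * (n : ℝ) ^ m := by ring
        _ ≤ ((∑ y, (d y : ℝ)) / n ^ m) ^ t * n ^ m := by gcongr
        _ ≤ _ := hj
        _ = _ := by exact_mod_cast hdR.symm
    have hbad : ∑ T with ¬ Function.Injective T, (#(R' T) : ℝ) ≤ δ ^ t / 2 * (n : ℝ) ^ (m + t) := by
      have h1 : ∀ T : V → X, (#(R' T) : ℝ) ≤ (n : ℝ) ^ m := fun T => by
        have := card_le_univ (R' T)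
        rw [Fintype.card_fun, Fintype.card_fin] at this
        exact_mod_cast this
      have h2 : (#{T : V → X | ¬ Function.Injective T} : ℝ) * n ≤ (t : ℝ) ^ 2 * (n : ℝ) ^ t := by
        exact_mod_cast card_filter_not_injective_le (V := V) (X := X)
      have h3 : (t : ℝ) ^ 2 ≤ δ ^ t / 2 * n := by
        rw [div_lt_iff₀ (by positivity)] at hnt
        linarith
      have h4 : (#{T : V → X | ¬ Function.Injective T} : ℝ) ≤ δ ^ t / 2 * (n : ℝ) ^ t := by
        refine le_of_mul_le_mul_right (h2.trans ?_) hn0'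
        calc _ ≤ (δ ^ t / 2 * n) * (n : ℝ) ^ t := by gcongr
          _ = _ := by ring
      calc _ ≤ ∑ T : V → X with ¬ Function.Injective T, (n : ℝ) ^ m := sum_le_sum fun T _ => h1 T
        _ = #{T : V → X | ¬ Function.Injective T} * (n : ℝ) ^ m := by simp
        _ ≤ δ ^ t / 2 * (n : ℝ) ^ t * (n : ℝ) ^ m := by gcongr
        _ = _ := by ring
    obtain ⟨T, hT, hRT⟩ : ∃ T : V → X, Function.Injective T ∧
        δ ^ t / 2 * (n : ℝ) ^ m ≤ #(R' T) := by
      by_contra! hc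
      have hgood : ∑ T with Function.Injective T, (#(R' T) : ℝ) < δ ^ t / 2 * (n : ℝ) ^ (m + t) := by
        obtain he | he := ({T : V → X | Function.Injective T} : Finset (V → X)).eq_empty_or_nonempty
        · rw [he, sum_empty]
          positivity
        · refine (sum_lt_sum_of_nonempty he fun T hT => hc T (by simpa using hT)).trans_le ?_
          have h1 : (#{T : V → X | Function.Injective T} : ℝ) ≤ (n : ℝ) ^ t := by
            have := card_le_univ ({T : V → X | Function.Injective T} : Finset (V → X))
            rw [Fintype.card_fun] at this
            exact_mod_cast this
          rw [sum_const, nsmul_eq_mul]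
          calc _ ≤ (n : ℝ) ^ t * (δ ^ t / 2 * (n : ℝ) ^ m) := by gcongr
            _ = _ := by ring
      have := sum_filter_add_sum_filter_not univ (fun T : V → X => Function.Injective T)
        fun T => (#(R' T) : ℝ)
      linarith
    obtain ⟨A, hA, hAR⟩ := hN X hNn (R' T) hRT
    refine ⟨Fin.cons T A, fun i => ?_, fun v => ?_⟩
    · induction i using Fin.cases with
      | zero => simpa using hT
      | succ i => simpa using hA i
    · have h := hAR (Fin.tail v)
      simp only [R', mem_filter, mem_univ, true_and] at h
      convert h (v 0) using 1
      funext i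
      induction i using Fin.cases with
      | zero => simp
      | succ i => simp [Fin.tail]

end DenseRelations

/-! ### Copies of complete uniform hypergraphs -/

namespace Hypergraph

theorem isIso_image {α β : Type*} {f : α → β} (hf : Function.Injective f) (K : Hypergraph α) :
    K.IsIso (K.image f) := by
  refine ⟨Equiv.Set.image f V(K) hf, fun e => ?_⟩
  have h : Subtype.val '' (Equiv.Set.image f V(K) hf '' e) = f '' (Subtype.val '' e) := by
    rw [Set.image_image, Set.image_image]
    rfl
  exact (hf.image_injective.mem_set_image (s := E(K))).symm.trans
    (iff_of_eq (congrArg (· ∈ E(K.image f)) h.symm))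

/-- The `r`-sets of vertices all of whose `k`-subsets are hyperedges. -/
def cliqueSets {α : Type*} (H : Hypergraph α) (k r : ℕ) : Set (Set α) :=
  {A | A.encard = r ∧ ∀ e ⊆ A, e.encard = k → e ∈ E(H)}

/-- A hypergraph is isomorphic to `K_r^{(k)}` iff it consists of `r` vertices and all their
`k`-subsets. -/
theorem completeUniform_isIso_iff {β : Type*} {k r : ℕ} {S : Hypergraph β} :
    (completeUniform k r).IsIso S ↔
      V(S).encard = r ∧ ∀ e, e ∈ E(S) ↔ e ⊆ V(S) ∧ e.encard = k := by
  have inj : Function.Injective (fun v : V(S) => (v : β)) := Subtype.val_injective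
  have inj' : Function.Injective (fun v : V(completeUniform k r) => (v : Fin r)) :=
    Subtype.val_injective
  have key : ∀ (f : V(completeUniform k r) ≃ V(S)) (e : Set V(completeUniform k r)),
      Subtype.val '' e ∈ E(completeUniform k r) ↔
        (Subtype.val '' (f '' e) : Set β).encard = k := by
    intro f e
    rw [inj.encard_image, f.injective.encard_image]
    change (Subtype.val '' e : Set (Fin r)).encard = k ↔ _
    rw [inj'.encard_image]
  have hcard : ENat.card V(completeUniform k r) = r := by
    change (Set.univ : Set (Fin r)).encard = r
    simp
  constructor
  · rintro ⟨f, hf⟩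
    refine ⟨?_, fun e => ?_⟩
    · rw [← hcard]
      exact (ENat.card_congr f).symm
    · have main : e ⊆ V(S) → (e ∈ E(S) ↔ e.encard = k) := by
        intro he
        obtain ⟨e', rfl⟩ : ∃ e' : Set V(completeUniform k r), Subtype.val '' (f '' e') = e := by
          refine ⟨f ⁻¹' (Subtype.val ⁻¹' e), ?_⟩
          rw [f.image_preimage, Subtype.image_preimage_coe, Set.inter_eq_right.2 he]
        rw [← hf, key f]
      constructor
      · intro h
        have hs := S.subset_vertexSet_of_mem_edgeSet' h
        exact ⟨hs, (main hs).1 h⟩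
      · rintro ⟨hs, h⟩
        exact (main hs).2 h
  · rintro ⟨hV, hE⟩
    have : Finite V(S) := Set.finite_of_encard_eq_coe hV
    have hc : ENat.card V(completeUniform k r) = ENat.card V(S) := hcard.trans hV.symm
    have : Finite V(completeUniform k r) := Subtype.finite
    rw [ENat.card_eq_coe_natCard, ENat.card_eq_coe_natCard, Nat.cast_inj] at hc
    obtain ⟨f⟩ := Finite.card_eq.1 hc
    refine ⟨f, fun e => ?_⟩
    rw [hE, key f]
    exact (and_iff_right (by simp)).symm

theorem numCopies_completeUniform {β : Type*} {k r : ℕ} {H : Hypergraph β}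
    (hH : V(H) = Set.univ) :
    numCopies (completeUniform k r) H = (H.cliqueSets k r).ncard := by
  refine Set.ncard_congr (fun S _ => V(S)) ?_ ?_ ?_
  · rintro S ⟨hS, hiso⟩
    rw [completeUniform_isIso_iff] at hiso
    exact ⟨hiso.1, fun e he hk => hS.2 ((hiso.2 e).2 ⟨he, hk⟩)⟩
  · rintro S S' ⟨-, hS⟩ ⟨-, hS'⟩ h
    rw [completeUniform_isIso_iff] at hS hS'
    refine Hypergraph.ext h (Set.ext fun e => ?_)
    rw [hS.2, hS'.2, show V(S) = V(S') from h]
  · rintro A ⟨hA, hAk⟩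
    refine ⟨⟨A, {e | e ⊆ A ∧ e.encard = k}, fun e he => he.1⟩, ⟨⟨?_, ?_⟩, ?_⟩, rfl⟩
    · rw [hH]
      exact Set.subset_univ _
    · exact fun e he => hAk e he.1 he.2
    · exact completeUniform_isIso_iff.2 ⟨hA, fun e => Iff.rfl⟩

end Hypergraph

section OrderedSets

open Finset

open scoped Classical in
/-- The injective `r`-tuples whose range belongs to a given family of sets. -/
noncomputable def orderings {X : Type*} [Fintype X] (r : ℕ) (𝒜 : Set (Set X)) :
    Finset (Fin r → X) :=
  {x | Function.Injective x ∧ Set.range x ∈ 𝒜}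

theorem card_orderings {X : Type*} [Fintype X] {r : ℕ} {𝒜 : Set (Set X)}
    (h𝒜 : ∀ A ∈ 𝒜, A.encard = r) : #(orderings r 𝒜) = r.factorial * 𝒜.ncard := by
  classical
  have hfib : ∀ A ∈ 𝒜.toFinset, #{x ∈ orderings r 𝒜 | Set.range x = A} = r.factorial := by
    intro A hA
    rw [Set.mem_toFinset] at hA
    have hc : Fintype.card (Fin r) = Fintype.card A := by
      have h := h𝒜 A hA
      rw [Set.encard_eq_coe_toFinset_card, Nat.cast_inj, Set.toFinset_card] at h
      rw [h, Fintype.card_fin]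
    have h := Fintype.card_equiv (Fintype.equivOfCardEq hc)
    rw [Fintype.card_fin] at h
    rw [← h, ← card_univ]
    symm
    refine card_bij (fun (σ : Fin r ≃ A) _ j => (σ j : X)) ?_ ?_ ?_
    · intro σ _
      have hr : Set.range (fun j => (σ j : X)) = A := by
        have := σ.surjective.range_comp (Subtype.val : A → X)
        rw [Subtype.range_coe] at this
        exact this
      simp only [orderings, mem_filter, mem_univ, true_and]
      exact ⟨⟨Subtype.val_injective.comp σ.injective, by rw [hr]; exact hA⟩, hr⟩
    · intro σ _ τ _ hστ
      ext j
      exact congrFun hστ j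
    · intro x hx
      simp only [orderings, mem_filter, mem_univ, true_and] at hx
      exact ⟨(Equiv.ofInjective x hx.1.1).trans (Equiv.setCongr hx.2), mem_univ _, rfl⟩
  rw [card_eq_sum_card_fiberwise (f := fun x => Set.range x) (t := 𝒜.toFinset), sum_congr rfl hfib,
    sum_const, smul_eq_mul, mul_comm, Set.ncard_eq_toFinset_card']
  intro x hx
  simp only [orderings, coe_filter, mem_univ, true_and] at hx
  simpa using hx.2

end OrderedSets

/-! ### Turán hypergraphs -/

namespace Hypergraph

/-- Since `k ≥ 2`, two vertices in the same part lie in a common `k`-subset, which is no edge. So the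
cliques of a Turán hypergraph are exactly the transversal `r`-sets. -/
theorem cliqueSets_turan {k r n t : ℕ} (hk : 2 ≤ k) (hkr : k ≤ r) :
    (turan k n t).cliqueSets k r = E(turan r n t) := by
  ext A
  constructor
  · rintro ⟨hA, h⟩
    refine ⟨hA, fun a ha b hb hab => ?_⟩
    by_contra hne
    obtain ⟨e, h₁, h₂, h₃⟩ := Set.exists_superset_subset_encard_eq (s := {a, b}) (t := A) (k := k)
      (Set.insert_subset ha (Set.singleton_subset_iff.2 hb))
      (by rw [Set.encard_pair hne]; exact_mod_cast hk) (by rw [hA]; exact_mod_cast hkr)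
    exact hne ((h e h₂ h₃).2 (h₁ (by simp)) (h₁ (by simp)) hab)
  · rintro ⟨hA, h⟩
    exact ⟨hA, fun e he hek => ⟨hek, h.mono he⟩⟩

/-- In a copy of an expansion in a `t`-partite hypergraph, the parts colour the original graph. -/
theorem isFree_expansion_turan {V : Type*} {F : SimpleGraph V} {k n t : ℕ} (ht : 0 < t)
    (hF : ¬ F.Colorable t) : IsFree (expansion F k) (turan k n t) := by
  rintro S hS ⟨f, hf⟩
  refine hF ⟨SimpleGraph.Coloring.mk
    (fun v => ⟨(f ⟨Sum.inl v, trivial⟩ : Fin n) % t, Nat.mod_lt _ ht⟩) fun {u v} huv h => ?_⟩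
  let e : Set (V ⊕ (F.edgeSet × Fin (k - 2))) :=
    Sum.inl '' {w : V | w ∈ s(u, v)} ∪
      Sum.inr '' {p : F.edgeSet × Fin (k - 2) | p.1 = ⟨s(u, v), huv⟩}
  have he : e ∈ E(expansion F k) := ⟨⟨s(u, v), huv⟩, rfl⟩
  have hval : Subtype.val '' (Subtype.val ⁻¹' e : Set V(expansion F k)) = e := by
    rw [Subtype.image_preimage_coe]
    exact Set.univ_inter _
  have hS' := (hS.2 ((hf (Subtype.val ⁻¹' e)).1 (by rw [hval]; exact he))).2
  have hmem : ∀ w (_ : w = u ∨ w = v), (f ⟨Sum.inl w, trivial⟩ : Fin n) ∈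
      Subtype.val '' (f '' (Subtype.val ⁻¹' e : Set V(expansion F k))) := by
    intro w hw
    refine ⟨_, ⟨⟨Sum.inl w, trivial⟩, ?_, rfl⟩, rfl⟩
    exact Or.inl ⟨w, by simpa using hw, rfl⟩
  have h' := hS' (hmem u (.inl rfl)) (hmem v (.inr rfl)) (by simpa using h)
  have h'' := congrArg Subtype.val (f.injective (Subtype.val_injective h'))
  exact huv.ne (Sum.inl_injective h'')

theorem le_ex_turan {V : Type*} {F : SimpleGraph V} {k r n t : ℕ} (ht : 0 < t)
    (hF : ¬ F.Colorable t) (hk : 2 ≤ k) (hkr : k ≤ r) :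
    E(turan r n t).ncard ≤ ex k n (completeUniform k r) (expansion F k) := by
  have hmem : E(turan r n t).ncard ∈ copyCounts k n (completeUniform k r) (expansion F k) :=
    ⟨turan k n t, rfl, fun e he => he.1, isFree_expansion_turan ht hF,
      by rw [numCopies_completeUniform rfl, cliqueSets_turan hk hkr]⟩
  exact (isGreatest_ex k n _ _ ⟨_, hmem⟩).2 hmem

/-- Choosing distinct residues modulo `t` and then arbitrary quotients below `n / t` gives ordered
edges of the Turán hypergraph. -/
theorem le_card_edgeSet_turan {r n t : ℕ} :
    t.descFactorial r * (n / t) ^ r ≤ r.factorial * E(turan r n t).ncard := by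
  classical
  rw [← card_orderings (𝒜 := E(turan r n t)) fun A hA => hA.1]
  have hc : t.descFactorial r * (n / t) ^ r =
      Fintype.card ((Fin r ↪ Fin t) × (Fin r → Fin (n / t))) := by
    simp [Fintype.card_embedding_eq]
  rw [hc, ← Finset.card_univ]
  have hlt : ∀ (a : Fin t) (b : Fin (n / t)), (a : ℕ) + t * b < n := by
    intro a b
    calc (a : ℕ) + t * b < t + t * b := by simp
      _ = t * (b + 1) := by ring
      _ ≤ t * (n / t) := Nat.mul_le_mul_left _ b.2
      _ ≤ n := Nat.mul_div_le n t
  have hmod : ∀ (a : Fin t) (b : ℕ), ((a : ℕ) + t * b) % t = a := by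
    intro a b
    rw [Nat.add_mul_mod_self_left, Nat.mod_eq_of_lt a.2]
  refine Finset.card_le_card_of_injOn
    (fun p i => (⟨p.1 i + t * p.2 i, hlt _ _⟩ : Fin n)) ?_ ?_
  · rintro ⟨σ, y⟩ -
    have hres : Function.Injective
        fun i => (((⟨σ i + t * y i, hlt _ _⟩ : Fin n) : ℕ) % t) := by
      intro i j hij
      simp only [hmod] at hij
      exact σ.injective (Fin.ext hij)
    have hinj : Function.Injective fun i => (⟨σ i + t * y i, hlt _ _⟩ : Fin n) :=
      Function.Injective.of_comp (f := fun v : Fin n => (v : ℕ) % t) hres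
    simp only [orderings, Finset.coe_filter, Finset.mem_univ, true_and, Set.mem_ofPred_eq]
    refine ⟨hinj, ?_, ?_⟩
    · rw [← Set.image_univ, hinj.encard_image]
      simp
    · rintro _ ⟨i, rfl⟩ _ ⟨j, rfl⟩ hij
      rw [hres hij]
  · rintro ⟨σ, y⟩ - ⟨σ', y'⟩ - h
    have hv : ∀ i, (σ i : ℕ) + t * y i = σ' i + t * y' i := fun i =>
      congrArg Fin.val (congrFun h i)
    have hσ : σ = σ' := by
      ext i
      have := congrArg (· % t) (hv i)
      simpa only [hmod] using this
    subst hσ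
    congr 1
    funext i
    have h0 : 0 < t := (Nat.zero_le _).trans_lt (σ i).2
    exact Fin.ext (Nat.eq_of_mul_eq_mul_left h0 (Nat.add_left_cancel (hv i)))

end Hypergraph

/-! ### Heavy pairs and the embedding of expansions -/

namespace Hypergraph

open Finset

variable {X : Type*}

/-- The graph of `M`-heavy pairs of a hypergraph: the pairs such that no set of at most `M` further
vertices meets all the hyperedges containing the pair. -/
def heavyGraph (H : Hypergraph X) (M : ℕ) : SimpleGraph X where
  Adj u v := u ≠ v ∧ ∀ W : Finset X, #W ≤ M → u ∉ W → v ∉ W →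
    ∃ e ∈ E(H), u ∈ e ∧ v ∈ e ∧ Disjoint e (W : Set X)
  symm := ⟨fun _ _ h => ⟨h.1.symm, fun W hW hu hv => by
    obtain ⟨e, he, h₁, h₂, h₃⟩ := h.2 W hW hv hu
    exact ⟨e, he, h₂, h₁, h₃⟩⟩⟩
  loopless := ⟨fun _ h => h.1 rfl⟩

/-- Greedy choice of the new vertices of an expansion: heavy pairs can be enlarged one after the
other to hyperedges, avoiding the vertices used before. -/
theorem exists_expansion_vertices {V : Type*} [Finite V] {F : SimpleGraph V} {k : ℕ}
    {H : Hypergraph X} (hH : H.IsUniform k) {φ : V → X} (hφ : Function.Injective φ)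
    (hadj : ∀ u v, F.Adj u v →
      (H.heavyGraph (Nat.card V + Nat.card F.edgeSet * (k - 2))).Adj (φ u) (φ v))
    (S : Finset F.edgeSet) :
    ∃ Y : F.edgeSet → Finset X, ∀ e ∈ S, #(Y e) = k - 2 ∧
      φ '' {v | v ∈ e.1} ∪ Y e ∈ E(H) ∧ (∀ v, φ v ∉ Y e) ∧
      ∀ e' ∈ S, e ≠ e' → Disjoint (Y e) (Y e') := by
  classical
  have := Fintype.ofFinite V
  have := Fintype.ofFinite F.edgeSet
  induction S using Finset.induction_on with
  | empty => exact ⟨fun _ => ∅, by simp⟩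
  | insert e S heS ih =>
    obtain ⟨Y, hY⟩ := ih
    obtain ⟨⟨u, v⟩, huv⟩ := e
    have huv' : F.Adj u v := huv
    let W : Finset X := (univ.image φ \ {φ u, φ v}) ∪ (S.biUnion Y)
    have hW : #W ≤ Nat.card V + Nat.card F.edgeSet * (k - 2) := by
      refine (card_union_le _ _).trans (Nat.add_le_add ?_ ?_)
      · rw [Nat.card_eq_fintype_card, ← card_univ]
        exact (card_le_card sdiff_subset).trans card_image_le
      · refine (card_biUnion_le_card_mul S Y (k - 2) fun e he => (hY e he).1.le).trans ?_
        rw [Nat.card_eq_fintype_card]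
        exact Nat.mul_le_mul_right _ (card_le_univ S)
    have hu : φ u ∉ W := by
      simp only [W, mem_union, Finset.mem_sdiff, mem_insert, true_or, not_true_eq_false, and_false,
        mem_biUnion, false_or, not_exists, not_and]
      exact fun e he => (hY e he).2.2.1 u
    have hv : φ v ∉ W := by
      simp only [W, mem_union, Finset.mem_sdiff, mem_insert, mem_singleton, or_true, not_true_eq_false,
        and_false, mem_biUnion, false_or, not_exists, not_and]
      exact fun e he => (hY e he).2.2.1 v
    obtain ⟨E, hE, huE, hvE, hdis⟩ := (hadj u v huv').2 W hW hu hv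
    have hEfin : E.Finite := Set.finite_of_encard_eq_coe (hH E hE)
    have hEcard : #hEfin.toFinset = k := by
      have := hH E hE
      rwa [hEfin.encard_eq_coe_toFinset_card, Nat.cast_inj] at this
    have hpair : {φ u, φ v} ⊆ hEfin.toFinset := by
      intro x hx
      rw [mem_insert, mem_singleton] at hx
      rw [Set.Finite.mem_toFinset]
      rcases hx with rfl | rfl <;> assumption
    let Z : Finset X := hEfin.toFinset \ {φ u, φ v}
    have hZ : ∀ x ∈ Z, x ∉ W := fun x hx hxW => by
      rw [Finset.mem_sdiff, Set.Finite.mem_toFinset] at hx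
      exact Set.disjoint_left.1 hdis hx.1 hxW
    have hZdis : ∀ e ∈ S, Disjoint Z (Y e) := fun e he =>
      disjoint_left.2 fun x hx hx' => hZ x hx (mem_union_right _ (mem_biUnion.2 ⟨e, he, hx'⟩))
    have hne : ∀ e ∈ S, e ≠ ⟨s(u, v), huv⟩ := fun e he h => heS (h ▸ he)
    refine ⟨Function.update Y ⟨s(u, v), huv⟩ Z, fun e he => ?_⟩
    obtain rfl | he := mem_insert.1 he
    · have hself : Function.update Y ⟨s(u, v), huv⟩ Z ⟨Quot.mk _ (u, v), huv⟩ = Z :=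
        Function.update_self ..
      rw [hself]
      refine ⟨?_, ?_, ?_, ?_⟩
      · rw [card_sdiff_of_subset hpair, hEcard, card_pair (hφ.ne huv'.ne)]
      · convert hE using 1
        ext x
        have hs : ∀ w, w ∈ (Quot.mk _ (u, v) : Sym2 V) ↔ w = u ∨ w = v := fun w => Sym2.mem_iff
        simp only [hs, Z, Set.mem_union, Set.mem_image, Set.mem_ofPred_eq, mem_coe, Finset.mem_sdiff,
          Set.Finite.mem_toFinset, mem_insert, mem_singleton]
        constructor
        · rintro (⟨w, rfl | rfl, rfl⟩ | h)
          · exact huE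
          · exact hvE
          · exact h.1
        · intro h
          by_cases hx : x = φ u ∨ x = φ v
          · left
            rcases hx with rfl | rfl
            · exact ⟨u, .inl rfl, rfl⟩
            · exact ⟨v, .inr rfl, rfl⟩
          · exact .inr ⟨h, hx⟩
      · intro w hw
        refine hZ _ hw (mem_union_left _ (Finset.mem_sdiff.2 ⟨mem_image_of_mem _ (mem_univ _), ?_⟩))
        exact (Finset.mem_sdiff.1 hw).2
      · intro e' he' hee'
        obtain rfl | he' := mem_insert.1 he'
        · exact absurd rfl hee'
        · rw [Function.update_of_ne (hne e' he')]
          exact hZdis e' he'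
    · rw [Function.update_of_ne (hne e he)]
      refine ⟨(hY e he).1, (hY e he).2.1, (hY e he).2.2.1, fun e' he' hee' => ?_⟩
      obtain rfl | he' := mem_insert.1 he'
      · have hself : Function.update Y ⟨s(u, v), huv⟩ Z ⟨Quot.mk _ (u, v), huv⟩ = Z :=
          Function.update_self ..
        rw [hself]
        exact (hZdis e he).symm
      · rw [Function.update_of_ne (hne e' he')]
        exact (hY e he).2.2.2 e' he' hee'

/-- A copy of `F` among the heavy pairs extends to a copy of its expansion. -/
theorem not_isFree_expansion {V : Type*} [Finite V] {F : SimpleGraph V} {k : ℕ}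
    {H : Hypergraph X} (hV : V(H) = Set.univ) (hH : H.IsUniform k) {φ : V → X}
    (hφ : Function.Injective φ)
    (hadj : ∀ u v, F.Adj u v →
      (H.heavyGraph (Nat.card V + Nat.card F.edgeSet * (k - 2))).Adj (φ u) (φ v)) :
    ¬ IsFree (expansion F k) H := by
  classical
  have := Fintype.ofFinite F.edgeSet
  obtain ⟨Y, hY⟩ := exists_expansion_vertices hH hφ hadj univ
  simp only [mem_univ, true_imp_iff] at hY
  let g : ∀ e, Fin (k - 2) ≃ Y e := fun e => ((Y e).equivFinOfCardEq (hY e).1).symm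
  let ψ : V ⊕ (F.edgeSet × Fin (k - 2)) → X := Sum.elim φ fun p => (g p.1 p.2 : X)
  have hψ : Function.Injective ψ := by
    refine hφ.sumElim ?_ ?_
    · rintro ⟨e, a⟩ ⟨e', a'⟩ h
      simp only at h
      obtain rfl : e = e' := by
        by_contra hne
        refine disjoint_left.1 ((hY e).2.2.2 e' hne) (g e a).2 ?_
        rw [h]
        exact (g e' a').2
      rw [(g e).injective (Subtype.val_injective h)]
    · rintro v ⟨e, a⟩ h
      refine (hY e).2.2.1 v ?_
      rw [h]
      exact (g e a).2
  intro hfree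
  refine hfree ((expansion F k).image ψ) ⟨?_, ?_⟩ (isIso_image hψ _)
  · rw [hV]
    exact Set.subset_univ _
  · intro E hE
    obtain ⟨_, ⟨e, rfl⟩, rfl⟩ := mem_edgeSet_image.1 hE
    convert (hY e).2.1 using 1
    rw [Set.image_union, Set.image_image, Set.image_image]
    congr 1
    ext x
    constructor
    · rintro ⟨⟨_, a⟩, rfl, rfl⟩
      exact (g _ a).2
    · intro hx
      refine ⟨(e, (g e).symm ⟨x, hx⟩), rfl, ?_⟩
      simp [ψ]

end Hypergraph

/-! ### Cliques containing a light pair -/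

namespace Hypergraph

open Finset

/-- If the `l`-th entry of a tuple is confined to one of `M` values determined by two other
entries, a factor `n / M` is lost among all tuples. -/
theorem card_filter_mem_le {X : Type*} [Fintype X] [DecidableEq X] {r M : ℕ} {i j l : Fin r}
    (hil : i ≠ l) (hjl : j ≠ l) (W : X → X → Finset X) (hW : ∀ u v, #(W u v) ≤ M) :
    #{x : Fin r → X | x l ∈ W (x i) (x j)} * Fintype.card X ≤ M * Fintype.card X ^ r := by
  classical
  rw [← card_univ, ← card_product]
  have h := card_le_mul_card_image (f := fun p : (Fin r → X) × X => Function.update p.1 l p.2)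
    (({x : Fin r → X | x l ∈ W (x i) (x j)} : Finset (Fin r → X)) ×ˢ (univ : Finset X)) M ?_
  · refine h.trans (Nat.mul_le_mul_left _ ?_)
    exact (card_le_univ _).trans (by rw [Fintype.card_fun, Fintype.card_fin, card_univ])
  · intro y _
    refine le_trans (card_le_card_of_injOn (fun p => p.1 l) (t := W (y i) (y j)) ?_ ?_) (hW _ _)
    · rintro ⟨x, w⟩ hx
      simp only [coe_filter, mem_product, mem_filter, mem_univ, true_and, and_true,
        Set.mem_ofPred_eq] at hx
      obtain ⟨hx, rfl⟩ := hx
      simpa [Function.update_of_ne hil, Function.update_of_ne hjl] using hx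
    · rintro ⟨x, w⟩ hx ⟨x', w'⟩ hx' h
      simp only [coe_filter, mem_product, mem_filter, mem_univ, true_and, and_true,
        Set.mem_ofPred_eq] at hx hx'
      simp only at h
      have hu := hx.2.trans hx'.2.symm
      have hw : w = w' := by simpa using congrFun hu l
      have hxx : x = x' := by
        funext c
        by_cases hc : c = l
        · rw [hc, h]
        · simpa [hc] using congrFun hu c
      rw [hw, hxx]

/-- All but `O(n ^ (r - 1))` ordered cliques of a uniform hypergraph are cliques of heavy pairs: a
clique through a light pair meets the small set that blocks the pair, for otherwise it would
contain a hyperedge through the pair that avoids this set. -/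
theorem card_orderings_cliqueSets_le {X : Type*} [Fintype X] (H : Hypergraph X) {k r : ℕ} (M : ℕ)
    (hk : 2 ≤ k) (hkr : k ≤ r) :
    #(orderings r (H.cliqueSets k r)) * Fintype.card X ≤
      #((H.heavyGraph M).orderedCliques r) * Fintype.card X + r ^ 3 * M * Fintype.card X ^ r := by
  classical
  have hblock : ∀ u v : X, ∃ W : Finset X, #W ≤ M ∧ (u ≠ v → ¬ (H.heavyGraph M).Adj u v →
      u ∉ W ∧ v ∉ W ∧ ∀ e ∈ E(H), u ∈ e → v ∈ e → ¬ Disjoint e (W : Set X)) := by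
    intro u v
    by_cases h : u ≠ v ∧ ¬ (H.heavyGraph M).Adj u v
    · have h2 := h.2
      simp only [heavyGraph, not_and, not_forall] at h2
      obtain ⟨W, hW, hu, hv, hWe⟩ := h2 h.1
      exact ⟨W, hW, fun _ _ => ⟨hu, hv, fun e he hue hve hd => hWe ⟨e, he, hue, hve, hd⟩⟩⟩
    · exact ⟨∅, by simp, fun h₁ h₂ => absurd ⟨h₁, h₂⟩ h⟩
  choose W hW hWb using hblock
  let B : Fin r × Fin r × Fin r → Finset (Fin r → X) := fun p =>
    if p.1 ≠ p.2.2 ∧ p.2.1 ≠ p.2.2 then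
      ({x : Fin r → X | x p.2.2 ∈ W (x p.1) (x p.2.1)} : Finset (Fin r → X)) else ∅
  have hB : ∀ p, #(B p) * Fintype.card X ≤ M * Fintype.card X ^ r := by
    intro p
    by_cases hp : p.1 ≠ p.2.2 ∧ p.2.1 ≠ p.2.2
    · simp only [B, if_pos hp]
      exact card_filter_mem_le hp.1 hp.2 W hW
    · simp [B, if_neg hp]
  have hsub : orderings r (H.cliqueSets k r) ⊆
      (H.heavyGraph M).orderedCliques r ∪ univ.biUnion B := by
    intro x hx
    simp only [orderings, mem_filter, mem_univ, true_and] at hx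
    obtain ⟨hinj, hcard, hx⟩ := hx
    by_cases hc : x ∈ (H.heavyGraph M).orderedCliques r
    · exact mem_union_left _ hc
    refine mem_union_right _ ?_
    simp only [SimpleGraph.mem_orderedCliques, Pairwise, not_forall] at hc
    obtain ⟨i, j, hij, hnadj⟩ := hc
    obtain ⟨hi, hj, hmeet⟩ := hWb (x i) (x j) (hinj.ne hij) hnadj
    obtain ⟨e, h₁, h₂, h₃⟩ := Set.exists_superset_subset_encard_eq (s := {x i, x j})
      (t := Set.range x) (k := k)
      (Set.insert_subset ⟨i, rfl⟩ (Set.singleton_subset_iff.2 ⟨j, rfl⟩))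
      (by rw [Set.encard_pair (hinj.ne hij)]; exact_mod_cast hk)
      (by rw [hcard]; exact_mod_cast hkr)
    obtain ⟨y, hye, hyW⟩ := Set.not_disjoint_iff.1
      (hmeet e (hx e h₂ h₃) (h₁ (by simp)) (h₁ (by simp)))
    obtain ⟨l, rfl⟩ := h₂ hye
    refine mem_biUnion.2 ⟨(i, j, l), mem_univ _, ?_⟩
    have hil : i ≠ l := fun h => hi (h ▸ hyW)
    have hjl : j ≠ l := fun h => hj (h ▸ hyW)
    simp only [B, if_pos (And.intro hil hjl), mem_filter, mem_univ, true_and]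
    exact hyW
  have h1 : #(univ.biUnion B) * Fintype.card X ≤ r ^ 3 * M * Fintype.card X ^ r := by
    calc _ ≤ (∑ p, #(B p)) * Fintype.card X := Nat.mul_le_mul_right _ card_biUnion_le
      _ = ∑ p, #(B p) * Fintype.card X := sum_mul ..
      _ ≤ ∑ p : Fin r × Fin r × Fin r, M * Fintype.card X ^ r := sum_le_sum fun p _ => hB p
      _ = _ := by
        simp
        ring
  calc _ ≤ (#((H.heavyGraph M).orderedCliques r) + #(univ.biUnion B)) * Fintype.card X :=
        Nat.mul_le_mul_right _ ((card_le_card hsub).trans (card_union_le _ _))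
    _ = #((H.heavyGraph M).orderedCliques r) * Fintype.card X +
        #(univ.biUnion B) * Fintype.card X := add_mul ..
    _ ≤ _ := Nat.add_le_add_left h1 _

end Hypergraph

/-! ### The asymptotics of the generalized Turán number -/

namespace Hypergraph

open Finset Topology

/-- In a hypergraph free of the expansion of a `(t + 1)`-colorable graph, the heavy pairs span few
`(t + 1)`-cliques: many cliques would give a complete `(t + 1)`-partite graph with large parts,
which contains the graph. -/
theorem exists_cliqueDensity_heavyGraph_le {V : Type*} [Finite V] {F : SimpleGraph V} {t : ℕ}
    (hF : F.Colorable (t + 1)) (k : ℕ) {δ : ℝ} (hδ : 0 < δ) :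
    ∃ N : ℕ, ∀ (X : Type) [Fintype X], N ≤ Fintype.card X → ∀ H : Hypergraph X,
      V(H) = Set.univ → H.IsUniform k → IsFree (expansion F k) H →
        (H.heavyGraph (Nat.card V + Nat.card F.edgeSet * (k - 2))).cliqueDensity (t + 1) ≤ δ := by
  obtain ⟨N, hN⟩ := exists_product_subset_of_dense V (t + 1) hδ
  obtain ⟨C⟩ := hF
  refine ⟨N + 1, fun X _ hX H hV hH hfree => ?_⟩
  by_contra! hc
  have hn : (0 : ℝ) < Fintype.card X := by exact_mod_cast (Nat.succ_pos N).trans_le hX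
  rw [SimpleGraph.cliqueDensity, lt_div_iff₀ (by positivity)] at hc
  obtain ⟨A, hA, hAR⟩ := hN X ((Nat.le_succ N).trans hX) _ hc.le
  have hadj : ∀ (i j : Fin (t + 1)) (u v : V), i ≠ j →
      (H.heavyGraph (Nat.card V + Nat.card F.edgeSet * (k - 2))).Adj (A i u) (A j v) := by
    intro i j u v hij
    have h := (SimpleGraph.mem_orderedCliques _).1 (hAR fun l => if l = i then u else v) hij
    simpa [hij.symm] using h
  refine not_isFree_expansion hV hH (φ := fun v => A (C v) v) ?_ ?_ hfree
  · intro u v huv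
    by_cases h : C u = C v
    · simp only [h] at huv
      exact hA _ huv
    · exact absurd huv (hadj _ _ u v h).ne
  · exact fun u v huv => hadj _ _ u v (C.valid huv)

/-- Up to `o(n ^ r)`, the ordered `r`-cliques of a hypergraph free of the expansion are `r`-cliques of
the heavy pairs, whose number is bounded by the Moon–Moser inequalities. -/
theorem eventually_ex_le {V : Type*} [Finite V] {F : SimpleGraph V} {t r k : ℕ}
    (hF : F.Colorable (t + 1)) (hrt : r ≤ t) (hk : 2 ≤ k) (hkr : k ≤ r) {ε : ℝ} (hε : 0 < ε) :
    ∀ᶠ n : ℕ in atTop, (r.factorial : ℝ) * ex k n (completeUniform k r) (expansion F k) ≤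
      (turanCliqueDensity t r + ε) * (n : ℝ) ^ r := by
  obtain ⟨δ, hδ, hdens⟩ := exists_cliqueDensity_le hrt (half_pos hε)
  obtain ⟨N, hN⟩ := exists_cliqueDensity_heavyGraph_le hF k hδ
  set M := Nat.card V + Nat.card F.edgeSet * (k - 2)
  obtain ⟨N', hN'⟩ := exists_nat_gt ((r : ℝ) ^ 3 * M / (ε / 2))
  filter_upwards [eventually_ge_atTop N, eventually_ge_atTop N', eventually_gt_atTop 0]
    with n hn hn' hn0
  have hn0' : (0 : ℝ) < n := by exact_mod_cast hn0
  have hpos := (turanCliqueDensity_pos hrt).le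
  obtain he | he := (copyCounts k n (completeUniform k r) (expansion F k)).eq_empty_or_nonempty
  · rw [ex, he, csSup_empty]
    simp only [Nat.bot_eq_zero, Nat.cast_zero, mul_zero]
    positivity
  obtain ⟨H, hV, hH, hfree, hex⟩ := (isGreatest_ex k n _ _ he).1
  rw [← hex, numCopies_completeUniform hV]
  have : Nonempty (Fin n) := ⟨⟨0, hn0⟩⟩
  have h1 := hdens (H.heavyGraph M) (hN (Fin n) (by simpa using hn) H hV hH hfree)
  have h2 := card_orderings_cliqueSets_le H M hk hkr
  rw [card_orderings fun A hA => hA.1, Fintype.card_fin] at h2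
  have h2' : (r.factorial * (H.cliqueSets k r).ncard * n : ℝ) ≤
      #((H.heavyGraph M).orderedCliques r) * n + r ^ 3 * M * (n : ℝ) ^ r := by
    exact_mod_cast h2
  rw [SimpleGraph.cliqueDensity, Fintype.card_fin, div_le_iff₀ (by positivity)] at h1
  have h3 : (r : ℝ) ^ 3 * M ≤ n * (ε / 2) := by
    rw [div_lt_iff₀ (by positivity)] at hN'
    have : (N' : ℝ) ≤ n := by exact_mod_cast hn'
    exact hN'.le.trans (by gcongr)
  refine le_of_mul_le_mul_right (h2'.trans ?_) hn0'
  calc _ ≤ (turanCliqueDensity t r + ε / 2) * (n : ℝ) ^ r * n + n * (ε / 2) * (n : ℝ) ^ r := by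
        gcongr
    _ = _ := by ring

theorem tendsto_descFactorial_mul_div_pow {t r : ℕ} (hr : r ≤ t) :
    Tendsto (fun n : ℕ => ((t.descFactorial r * (n / t) ^ r : ℕ) : ℝ) / (n : ℝ) ^ r) atTop
      (𝓝 (turanCliqueDensity t r)) := by
  have h := (tendsto_nat_floor_mul_div_atTop (R := ℝ) (a := (t : ℝ)⁻¹) (by positivity)).comp
    tendsto_natCast_atTop_atTop
  have h' := (h.pow r).const_mul (t.descFactorial r : ℝ)
  rw [turanCliqueDensity_eq hr, div_eq_mul_inv, ← inv_pow]
  refine h'.congr fun n => ?_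
  have : ⌊(t : ℝ)⁻¹ * n⌋₊ = n / t := by
    rw [mul_comm, ← div_eq_mul_inv, Nat.floor_div_eq_div]
  simp only [Function.comp_apply, this]
  push_cast
  rw [div_pow, mul_div_assoc]

end Hypergraph

/-- For a finite graph `F₀` with chromatic number `m > r > k ≥ 2`, as `n → ∞`,
`ex_k(n, K_r^{(k)}, F₀^{+k}) = (1 + o(1)) |E(T^r(n, m - 1))|`. -/
theorem corollary5p3 {V : Type*} [Finite V] (F₀ : SimpleGraph V) (m r k : ℕ)
    (hm : F₀.chromaticNumber = m) (hmr : r < m) (hrk : k < r) (hk : 2 ≤ k) :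
    (fun n : ℕ => (Hypergraph.ex k n (Hypergraph.completeUniform k r)
        (Hypergraph.expansion F₀ k) : ℝ))
      ~[atTop] (fun n : ℕ => ((Hypergraph.turan r n (m - 1)).edgeSet.ncard : ℝ)) := by
  obtain ⟨t, rfl⟩ : ∃ t, m = t + 1 := ⟨m - 1, by omega⟩
  have hrt : r ≤ t := Nat.lt_succ_iff.1 hmr
  have hcol : F₀.Colorable (t + 1) := SimpleGraph.chromaticNumber_le_iff_colorable.1 hm.le
  have hncol : ¬ F₀.Colorable t := by
    rw [← SimpleGraph.chromaticNumber_le_iff_colorable, hm, Nat.cast_le]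
    exact Nat.not_succ_le_self t
  rw [Nat.add_sub_cancel]
  set L := turanCliqueDensity t r
  have hL : 0 < L := turanCliqueDensity_pos hrt
  set u : ℕ → ℝ := fun n => (Hypergraph.ex k n (Hypergraph.completeUniform k r)
        (Hypergraph.expansion F₀ k) : ℝ)
  set v : ℕ → ℝ := fun n => ((Hypergraph.turan r n t).edgeSet.ncard : ℝ)
  have hvu : ∀ n, v n ≤ u n := fun n => by
    exact Nat.cast_le.2 (Hypergraph.le_ex_turan (by omega) hncol hk hrk.le)
  have hlow : ∀ n : ℕ, ((t.descFactorial r * (n / t) ^ r : ℕ) : ℝ) / (n : ℝ) ^ r ≤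
      r.factorial * v n / (n : ℝ) ^ r := fun n => by
    gcongr
    simp only [v]
    exact_mod_cast Hypergraph.le_card_edgeSet_turan (r := r) (n := n) (t := t)
  have hvu' : ∀ n : ℕ, r.factorial * v n / (n : ℝ) ^ r ≤ r.factorial * u n / (n : ℝ) ^ r :=
    fun n => by gcongr; exact hvu n
  have hup : ∀ b > L, ∀ᶠ n : ℕ in atTop, r.factorial * u n / (n : ℝ) ^ r < b := by
    intro b hb
    filter_upwards [Hypergraph.eventually_ex_le hcol hrt hk hrk.le (half_pos (sub_pos.2 hb)),
      eventually_gt_atTop 0] with n hn hn0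
    have hn0' : (0 : ℝ) < n := by exact_mod_cast hn0
    rw [div_lt_iff₀ (by positivity)]
    refine hn.trans_lt ?_
    gcongr
    linarith
  have hlim := Hypergraph.tendsto_descFactorial_mul_div_pow hrt
  have hu : Tendsto (fun n : ℕ => r.factorial * u n / (n : ℝ) ^ r) atTop (nhds L) := by
    refine tendsto_order.2 ⟨fun a ha => ?_, hup⟩
    filter_upwards [(tendsto_order.1 hlim).1 a ha] with n hn
    exact hn.trans_le ((hlow n).trans (hvu' n))
  have hv : Tendsto (fun n : ℕ => r.factorial * v n / (n : ℝ) ^ r) atTop (nhds L) :=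
    tendsto_of_tendsto_of_tendsto_of_le_of_le hlim hu hlow hvu'
  have hv0 : ∀ᶠ n in atTop, v n ≠ 0 := by
    filter_upwards [(tendsto_order.1 hv).1 0 hL] with n hn h
    simp [h] at hn
  rw [isEquivalent_iff_tendsto_one hv0]
  have h := hu.div hv hL.ne'
  rw [div_self hL.ne'] at h
  refine h.congr' ?_
  filter_upwards [hv0, eventually_gt_atTop 0] with n hn hn0
  have hn0' : (0 : ℝ) < n := by exact_mod_cast hn0
  have hf : (r.factorial : ℝ) ≠ 0 := by exact_mod_cast r.factorial_ne_zero
  simp only [Pi.div_apply]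
  field_simp
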